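/- For real $x,y$ write $\binom{x}{y}=\frac{\Gamma(x+1)}{\Gamma(y+1)\,\Gamma(x-y+1)}$. Let $\mu^{(k)}$, $k\in\mathbb N_0$, be finite Borel measures on $\mathbb R$ with bounded and infinite support. Let $p_l^{(k)}$ be the orthonormal polynomials of $\mu^{(k)}$ ($\deg p_l^{(k)}=l$, positive leading coefficient), with three-term recurrence $$x\,p_l^{(k)}(x)=b_{l+1}^{(k)}p_{l+1}^{(k)}(x)+a_l^{(k)}p_l^{(k)}(x)+b_l^{(k)}p_{l-1}^{(k)}(x),\qquad p_{-1}^{(k)}=0,\ b_0^{(k)}=0.$$ Let $\alpha>0$, $a\in\mathbb R$, $b>0$, and let $\sigma_{n,k}=\binom{n-k+\alpha-1}{n-k}\big/\binom{n+\alpha}{n}$, $0\le k\le n$, be the weights of Cesàro $(C,\alpha)$ summation. Suppose that the family is in the mean Nevai class $M^{(C,\alpha)}(\Sigma_{l_a,l_b})$, that is, 1. $\sup_{n,k\in\mathbb N_0}|a_n^{(k)}|<\infty$ and $\sup_{n,k\in\mathbb N_0}|b_n^{(k)}|<\infty$; 2. $\lim_{n\to\infty}\sum_{k=0}^n\sigma_{n,k}|a_{k+l}^{(n-k)}-a_k^{(n-k)}|=0$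 and $\lim_{n\to\infty}\sum_{k=0}^n\sigma_{n,k}|b_{k+l}^{(n-k)}-b_k^{(n-k)}|=0$ for every integer $l\ge 1$; 3. $\lim_{n\to\infty}\sum_{k=0}^n\sigma_{n,k}(a_k^{(n-k)})^{l_a}(b_k^{(n-k)})^{l_b}=\Sigma_{l_a,l_b}$ for all $l_a,l_b\in\mathbb N_0$, with the limits $$\Sigma_{l_a,l_b}=a^{l_a}\,b^{l_b}\binom{\frac{\alpha+l_b}{2}}{\frac{\alpha}{2}}^{-1}.$$ Then the mean measures $d\bar\mu_n=\sum_{k=0}^n\sigma_{n,k}\,(p_k^{(n-k)}(x))^2\,d\mu^{(n-k)}$ have a unique equilibrium measure $\mu_\Sigma$, i.e. a unique Borel measure $\mu_\Sigma$ such that every continuous $f:\mathbb R\to\mathbb R$ is integrable with respect to $\mu_\Sigma$ and all $\bar\mu_n$, and $\lim_{n\to\infty}\int f\,d\bar\mu_n=\int f\,d\mu_\Sigma$. It is given by $$d\mu_\Sigma=\frac{1}{2\pi b^{\alpha}\binom{\alpha-1}{\frac{\alpha}{2}}}\,\chi_{[a-2b,\,a+2b]}(x)\,\bigl(4b^2-(x-a)^2\bigr)^{\frac{\alpha-1}{2}}\,dx.$$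 Moreover, $\mu_\Sigma$ is the image, under the map $y\mapsto 2by+a$, of the normalized Gegenbauer measure on $[-1,1]$ with density $(1-y^2)^{\frac{\alpha-1}{2}}\big/\int_{-1}^1(1-t^2)^{\frac{\alpha-1}{2}}dt$. -/

import Mathlib

open MeasureTheory Filter Topology Polynomial

namespace MeanNevai

noncomputable section

/-! ### Orthonormal polynomials on the real line -/

/-- A finite Borel measure on the line with bounded support, whose support is an infinite set, so
that there is an orthonormal polynomial of every degree. -/
structure IsOrthogonalityMeasure (μ : Measure ℝ) : Prop where
  finite : IsFiniteMeasure μ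
  bounded : Bornology.IsBounded μ.support
  infinite : μ.support.Infinite

/-- The inner product `⟨f, g⟩ = ∫ f g dμ` of real polynomials. -/
def polyInner (μ : Measure ℝ) (f g : ℝ[X]) : ℝ := ∫ x, f.eval x * g.eval x ∂μ

/-- The monic orthogonal polynomials of `μ`: Gram-Schmidt applied to `1, X, X ^ 2, …`. -/
def monicOrtho (μ : Measure ℝ) (n : ℕ) : ℝ[X] :=
  X ^ n - ∑ j : Fin n,
    C (polyInner μ (X ^ n) (monicOrtho μ j) / polyInner μ (monicOrtho μ j) (monicOrtho μ j)) *
      monicOrtho μ j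
termination_by n
decreasing_by exact j.2

/-- The orthonormal polynomial `p_n` of `μ`, of degree `n` and with positive leading coefficient. -/
def orthoPoly (μ : Measure ℝ) (n : ℕ) : ℝ[X] :=
  C (Real.sqrt (polyInner μ (monicOrtho μ n) (monicOrtho μ n)))⁻¹ * monicOrtho μ n

/-- The diagonal coefficient `a_l` in
`x p_l = b_{l+1} p_{l+1} + a_l p_l + b_l p_{l-1}`; see `threeTermRecurrence`. -/
def recA (μ : Measure ℝ) (l : ℕ) : ℝ := polyInner μ (X * orthoPoly μ l) (orthoPoly μ l)

/-- The off-diagonal coefficient `b_l` in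
`x p_l = b_{l+1} p_{l+1} + a_l p_l + b_l p_{l-1}`, with the convention `b_0 = 0`. -/
def recB (μ : Measure ℝ) : ℕ → ℝ
  | 0 => 0
  | l + 1 => polyInner μ (X * orthoPoly μ (l + 1)) (orthoPoly μ l)

/-! Basic facts: these polynomials are orthonormal of the right degree with positive leading
coefficient, and satisfy the three-term recurrence. -/

section basic

variable {μ : Measure ℝ}

lemma integrable_continuous (h : IsOrthogonalityMeasure μ) {f : ℝ → ℝ} (hf : Continuous f) :
    Integrable f μ := by
  have := h.finite
  have hc : IsCompact (closure μ.support) := h.bounded.isCompact_closure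
  obtain ⟨K, hK⟩ := hc.exists_bound_of_continuousOn hf.continuousOn
  refine Integrable.of_bound hf.aestronglyMeasurable K ?_
  filter_upwards [Measure.support_mem_ae (μ := μ)] with x hx
  exact hK x (subset_closure hx)

lemma integrable_mul (h : IsOrthogonalityMeasure μ) (f g : ℝ[X]) :
    Integrable (fun x => f.eval x * g.eval x) μ :=
  integrable_continuous h (f.continuous.mul g.continuous)

lemma polyInner_comm (f g : ℝ[X]) : polyInner μ f g = polyInner μ g f := by
  simp only [polyInner, mul_comm]

lemma polyInner_X_mul (f g : ℝ[X]) : polyInner μ (X * f) g = polyInner μ f (X * g) := by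
  simp only [polyInner, eval_mul, eval_X]
  congr 1; ext x; ring

lemma polyInner_C_mul (c : ℝ) (f g : ℝ[X]) : polyInner μ (C c * f) g = c * polyInner μ f g := by
  simp only [polyInner, eval_mul, eval_C, mul_assoc, integral_const_mul]

lemma polyInner_add (h : IsOrthogonalityMeasure μ) (f f' g : ℝ[X]) :
    polyInner μ (f + f') g = polyInner μ f g + polyInner μ f' g := by
  simp only [polyInner, eval_add, add_mul]
  exact integral_add (integrable_mul h _ _) (integrable_mul h _ _)

lemma polyInner_sub (h : IsOrthogonalityMeasure μ) (f f' g : ℝ[X]) :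
    polyInner μ (f - f') g = polyInner μ f g - polyInner μ f' g := by
  simp only [polyInner, eval_sub, sub_mul]
  exact integral_sub (integrable_mul h _ _) (integrable_mul h _ _)

lemma polyInner_sum (h : IsOrthogonalityMeasure μ) {ι : Type*} (s : Finset ι) (f : ι → ℝ[X])
    (g : ℝ[X]) : polyInner μ (∑ i ∈ s, f i) g = ∑ i ∈ s, polyInner μ (f i) g := by
  simp only [polyInner, eval_finsetSum, Finset.sum_mul]
  exact integral_finsetSum _ fun i _ => integrable_mul h _ _

lemma eq_zero_of_polyInner_self (h : IsOrthogonalityMeasure μ) {q : ℝ[X]}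
    (hq : polyInner μ q q = 0) : q = 0 := by
  by_contra hne
  have h0 := (integral_eq_zero_iff_of_nonneg (fun x => mul_self_nonneg (q.eval x))
    (integrable_mul h q q)).1 hq
  refine h.infinite ((q.roots.toFinset.finite_toSet).subset ?_)
  refine Measure.support_subset_of_isClosed (Set.Finite.isClosed (Finset.finite_toSet _)) ?_
  filter_upwards [h0] with x hx
  simpa [hne] using hx

lemma polyInner_self_pos (h : IsOrthogonalityMeasure μ) {q : ℝ[X]} (hq : q ≠ 0) :
    0 < polyInner μ q q :=
  lt_of_le_of_ne (integral_nonneg fun x => mul_self_nonneg (q.eval x))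
    fun e => hq (eq_zero_of_polyInner_self h e.symm)

lemma monicOrtho_monic_natDegree (n : ℕ) :
    (monicOrtho μ n).Monic ∧ (monicOrtho μ n).natDegree = n := by
  induction n using Nat.strong_induction_on with
  | _ n ih =>
    have hlt : (∑ j : Fin n, C (polyInner μ (X ^ n) (monicOrtho μ j) /
        polyInner μ (monicOrtho μ j) (monicOrtho μ j)) * monicOrtho μ j).degree < (n : ℕ) := by
      refine (degree_sum_le _ _).trans_lt ((Finset.sup_lt_iff (WithBot.bot_lt_coe n)).2 ?_)
      intro j _
      refine lt_of_le_of_lt ?_ (Nat.cast_lt.2 j.2)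
      refine natDegree_le_iff_degree_le.1 ((natDegree_C_mul_le _ _).trans (ih j j.2).2.le)
    rw [monicOrtho]
    have hm := monic_X_pow_sub (n := n) hlt
    refine ⟨hm, ?_⟩
    have hd : (X ^ n - ∑ j : Fin n, C (polyInner μ (X ^ n) (monicOrtho μ j) /
        polyInner μ (monicOrtho μ j) (monicOrtho μ j)) * monicOrtho μ j).degree = ((n : ℕ) : WithBot ℕ) := by
      rw [degree_sub_eq_left_of_degree_lt (by rwa [degree_X_pow]), degree_X_pow]
    exact natDegree_eq_of_degree_eq_some hd

lemma monicOrtho_orthogonal (h : IsOrthogonalityMeasure μ) (n : ℕ) :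
    ∀ m < n, polyInner μ (monicOrtho μ n) (monicOrtho μ m) = 0 := by
  induction n using Nat.strong_induction_on with
  | _ n ih =>
    intro m hm
    have hpos := polyInner_self_pos h (monicOrtho_monic_natDegree (μ := μ) m).1.ne_zero
    rw [monicOrtho, polyInner_sub h, polyInner_sum h,
      Finset.sum_eq_single (⟨m, hm⟩ : Fin n)]
    · rw [polyInner_C_mul, div_mul_cancel₀ _ hpos.ne', sub_self]
    · intro j _ hj
      have hjm : (j : ℕ) ≠ m := fun e => hj (Fin.ext e)
      rw [polyInner_C_mul]
      rcases lt_or_gt_of_ne hjm with hlt | hlt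
      · rw [polyInner_comm (monicOrtho μ j) (monicOrtho μ m), ih m hm j hlt, mul_zero]
      · rw [ih j j.2 m hlt, mul_zero]
    · intro hn; exact absurd (Finset.mem_univ _) hn

lemma monicOrtho_orthogonal_lower (h : IsOrthogonalityMeasure μ) (n : ℕ) :
    ∀ (d : ℕ) (q : ℝ[X]), q.degree < (d : ℕ) → d ≤ n →
      polyInner μ (monicOrtho μ n) q = 0 := by
  intro d
  induction d with
  | zero =>
    intro q hq _
    have : q = 0 := by simpa using hq
    simp [this, polyInner]
  | succ d ih =>
    intro q hq hd
    obtain ⟨hm, hdeg⟩ := monicOrtho_monic_natDegree (μ := μ) d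
    have hr : (q - C (q.coeff d) * monicOrtho μ d).degree < (d : ℕ) := by
      rw [degree_lt_iff_coeff_zero]
      intro m hdm
      rcases hdm.eq_or_lt with rfl | hlt
      · have : (monicOrtho μ d).coeff d = 1 := by
          have := hm.coeff_natDegree; rwa [hdeg] at this
        simp [this]
      · have h1 : q.coeff m = 0 := (degree_lt_iff_coeff_zero _ _).1 hq m hlt
        have h2 : (monicOrtho μ d).coeff m = 0 :=
          coeff_eq_zero_of_natDegree_lt (by rwa [hdeg])
        simp [h1, h2]
    have e : q = (q - C (q.coeff d) * monicOrtho μ d) + C (q.coeff d) * monicOrtho μ d := by ring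
    rw [e, polyInner_comm, polyInner_add h, polyInner_C_mul, polyInner_comm, ih _ hr (by omega),
      polyInner_comm, monicOrtho_orthogonal h n d (by omega), mul_zero, add_zero]

lemma orthoPoly_orthonormal (h : IsOrthogonalityMeasure μ) (m n : ℕ) :
    polyInner μ (orthoPoly μ m) (orthoPoly μ n) = if m = n then 1 else 0 := by
  have hpos := fun k => polyInner_self_pos h (monicOrtho_monic_natDegree (μ := μ) k).1.ne_zero
  rw [orthoPoly, orthoPoly, polyInner_C_mul, polyInner_comm (monicOrtho μ m) (C _ * monicOrtho μ n),
    polyInner_C_mul]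
  split_ifs with e
  · subst e
    rw [← mul_assoc, ← mul_inv, Real.mul_self_sqrt (hpos m).le, inv_mul_cancel₀ (hpos m).ne']
  · rcases lt_or_gt_of_ne e with hlt | hlt
    · rw [monicOrtho_orthogonal h n m hlt]; ring
    · rw [polyInner_comm (monicOrtho μ n) (monicOrtho μ m), monicOrtho_orthogonal h m n hlt]; ring

lemma orthoPoly_leadingCoeff_pos (h : IsOrthogonalityMeasure μ) (n : ℕ) :
    0 < (orthoPoly μ n).leadingCoeff := by
  obtain ⟨hm, _⟩ := monicOrtho_monic_natDegree (μ := μ) n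
  rw [orthoPoly, leadingCoeff_mul, leadingCoeff_C, hm.leadingCoeff, mul_one]
  exact inv_pos.2 (Real.sqrt_pos.2 (polyInner_self_pos h hm.ne_zero))

lemma orthoPoly_natDegree (h : IsOrthogonalityMeasure μ) (n : ℕ) :
    (orthoPoly μ n).natDegree = n := by
  obtain ⟨hm, hd⟩ := monicOrtho_monic_natDegree (μ := μ) n
  rw [orthoPoly, natDegree_C_mul, hd]
  exact (inv_pos.2 (Real.sqrt_pos.2 (polyInner_self_pos h hm.ne_zero))).ne'

lemma orthoPoly_orthogonal_lower (h : IsOrthogonalityMeasure μ) (n : ℕ) (q : ℝ[X])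
    (hq : q.degree < (n : ℕ)) : polyInner μ (orthoPoly μ n) q = 0 := by
  rw [orthoPoly, polyInner_C_mul, monicOrtho_orthogonal_lower h n n q hq le_rfl, mul_zero]

lemma eq_zero_of_orthogonal (h : IsOrthogonalityMeasure μ) (d : ℕ) (q : ℝ[X])
    (hq : q.degree < (d : ℕ)) (ho : ∀ j < d, polyInner μ q (orthoPoly μ j) = 0) : q = 0 := by
  induction d generalizing q with
  | zero => simpa using hq
  | succ d ih =>
    refine ih q ?_ fun j hj => ho j (by omega)
    have hl := orthoPoly_leadingCoeff_pos h d
    have hnd := orthoPoly_natDegree h d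
    set c := q.coeff d / (orthoPoly μ d).leadingCoeff with hc
    have hr : (q - C c * orthoPoly μ d).degree < (d : ℕ) := by
      rw [degree_lt_iff_coeff_zero]
      intro m hdm
      rcases hdm.eq_or_lt with rfl | hlt
      · have : (orthoPoly μ d).coeff d = (orthoPoly μ d).leadingCoeff := by
          rw [leadingCoeff, hnd]
        rw [coeff_sub, coeff_C_mul, this, hc, div_mul_cancel₀ _ hl.ne', sub_self]
      · have h1 : q.coeff m = 0 := (degree_lt_iff_coeff_zero _ _).1 hq m hlt
        have h2 : (orthoPoly μ d).coeff m = 0 :=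
          coeff_eq_zero_of_natDegree_lt (by rwa [hnd])
        simp [h1, h2]
    have e1 := orthoPoly_orthogonal_lower h d _ hr
    rw [polyInner_comm, polyInner_sub h, ho d (by omega), polyInner_C_mul,
      orthoPoly_orthonormal h, if_pos rfl] at e1
    have hc0 : c = 0 := by linarith
    simpa [hc0] using hr

lemma X_mul_orthoPoly_far (h : IsOrthogonalityMeasure μ) {l j : ℕ} (hj : j + 1 < l) :
    polyInner μ (X * orthoPoly μ l) (orthoPoly μ j) = 0 := by
  rw [polyInner_X_mul]
  refine orthoPoly_orthogonal_lower h l _ ?_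
  have hd : (X * orthoPoly μ j).natDegree ≤ 1 + j := by
    refine natDegree_mul_le.trans ?_
    rw [natDegree_X, orthoPoly_natDegree h]
  exact lt_of_le_of_lt (natDegree_le_iff_degree_le.1 hd) (Nat.cast_lt.2 (by omega))

/-- The three-term recurrence `x p_l = b_{l+1} p_{l+1} + a_l p_l + b_l p_{l-1}`; for `l = 0` the
last term vanishes because `b_0 = 0`. -/
theorem threeTermRecurrence (h : IsOrthogonalityMeasure μ) (l : ℕ) :
    X * orthoPoly μ l = C (recB μ (l + 1)) * orthoPoly μ (l + 1) + C (recA μ l) * orthoPoly μ l +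
      C (recB μ l) * orthoPoly μ (l - 1) := by
  have hnd := orthoPoly_natDegree h
  have hdeg : ∀ (c : ℝ) (k : ℕ), k < l + 2 →
      (C c * orthoPoly μ k).degree < ((l + 2 : ℕ) : WithBot ℕ) := by
    intro c k hk
    refine lt_of_le_of_lt (natDegree_le_iff_degree_le.1
      ((natDegree_C_mul_le c (orthoPoly μ k)).trans (hnd k).le)) (Nat.cast_lt.2 hk)
  have hX : (X * orthoPoly μ l).degree < ((l + 2 : ℕ) : WithBot ℕ) := by
    have hd : (X * orthoPoly μ l).natDegree ≤ 1 + l := by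
      refine natDegree_mul_le.trans ?_
      rw [natDegree_X, hnd]
    exact lt_of_le_of_lt (natDegree_le_iff_degree_le.1 hd) (Nat.cast_lt.2 (by omega))
  refine sub_eq_zero.1 (eq_zero_of_orthogonal h (l + 2) _ ?_ ?_)
  · refine (degree_sub_le _ _).trans_lt (max_lt hX ?_)
    refine (degree_add_le _ _).trans_lt (max_lt ?_ (hdeg _ _ (by omega)))
    exact (degree_add_le _ _).trans_lt (max_lt (hdeg _ _ (by omega)) (hdeg _ _ (by omega)))
  · intro j hj
    rw [polyInner_sub h, polyInner_add h, polyInner_add h, polyInner_C_mul, polyInner_C_mul,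
      polyInner_C_mul, orthoPoly_orthonormal h, orthoPoly_orthonormal h, orthoPoly_orthonormal h]
    rcases lt_trichotomy j l with hlt | rfl | hgt
    · obtain ⟨k, rfl⟩ : ∃ k, l = k + 1 := ⟨l - 1, by omega⟩
      rw [if_neg (by omega), if_neg (by omega)]
      by_cases hk : j = k
      · subst hk
        have e : recB μ (j + 1) = polyInner μ (X * orthoPoly μ (j + 1)) (orthoPoly μ j) := rfl
        rw [Nat.add_sub_cancel, if_pos rfl, e]; ring
      · rw [Nat.add_sub_cancel, if_neg (fun e => hk e.symm), X_mul_orthoPoly_far h (by omega)]; ring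
    · rw [if_neg (by omega), if_pos rfl, recA]
      rcases j with _ | k
      · rw [recB]; ring
      · rw [if_neg (by omega)]; ring
    · obtain rfl : j = l + 1 := by omega
      rw [if_pos rfl, if_neg (by omega), if_neg (by omega), recB,
        polyInner_X_mul, polyInner_comm]; ring

theorem recB_succ_pos (h : IsOrthogonalityMeasure μ) (l : ℕ) : 0 < recB μ (l + 1) := by
  have e := congrArg (fun q : ℝ[X] => q.coeff (l + 1)) (threeTermRecurrence h l)
  have hnd := orthoPoly_natDegree h
  have c0 : (orthoPoly μ l).coeff (l + 1) = 0 :=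
    coeff_eq_zero_of_natDegree_lt (by rw [hnd]; omega)
  have c1 : (orthoPoly μ (l - 1)).coeff (l + 1) = 0 :=
    coeff_eq_zero_of_natDegree_lt (by rw [hnd]; omega)
  have c2 : (orthoPoly μ l).coeff l = (orthoPoly μ l).leadingCoeff := by rw [leadingCoeff, hnd]
  have c3 : (orthoPoly μ (l + 1)).coeff (l + 1) = (orthoPoly μ (l + 1)).leadingCoeff := by
    rw [leadingCoeff, hnd]
  simp only [coeff_X_mul, coeff_add, coeff_C_mul, c0, c1, c2, c3, mul_zero, add_zero] at e
  exact pos_of_mul_pos_left (e ▸ orthoPoly_leadingCoeff_pos h l)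
    (orthoPoly_leadingCoeff_pos h (l + 1)).le

end basic

/-! ### Mean Nevai classes and equilibrium measures -/

/-- A family `μ 0, μ 1, …` is in the mean Nevai class of the summation method with weights `σ n k`
(`0 ≤ k ≤ n`) and the limits `S i j`. -/
structure MeanNevaiClass (σ : ℕ → ℕ → ℝ) (μ : ℕ → Measure ℝ) (S : ℕ → ℕ → ℝ) : Prop where
  bounded_a : ∃ A : ℝ, ∀ n k, |recA (μ k) n| ≤ A
  bounded_b : ∃ B : ℝ, ∀ n k, |recB (μ k) n| ≤ B
  shift_a : ∀ l : ℕ, 1 ≤ l → Tendsto (fun n : ℕ => ∑ k ∈ Finset.range (n + 1),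
    σ n k * |recA (μ (n - k)) (k + l) - recA (μ (n - k)) k|) atTop (𝓝 0)
  shift_b : ∀ l : ℕ, 1 ≤ l → Tendsto (fun n : ℕ => ∑ k ∈ Finset.range (n + 1),
    σ n k * |recB (μ (n - k)) (k + l) - recB (μ (n - k)) k|) atTop (𝓝 0)
  limits : ∀ i j : ℕ, Tendsto (fun n : ℕ => ∑ k ∈ Finset.range (n + 1),
    σ n k * (recA (μ (n - k)) k ^ i * recB (μ (n - k)) k ^ j)) atTop (𝓝 (S i j))

/-- The mean measure `∑_{k ≤ n} σ_{n,k} (p_k^{(n-k)})² dμ^{(n-k)}`. -/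
def meanMeasure (σ : ℕ → ℕ → ℝ) (μ : ℕ → Measure ℝ) (n : ℕ) : Measure ℝ :=
  ∑ k ∈ Finset.range (n + 1), ENNReal.ofReal (σ n k) •
    (μ (n - k)).withDensity fun x => ENNReal.ofReal ((orthoPoly (μ (n - k)) k).eval x ^ 2)

/-- `ν` is the equilibrium measure of the family `μ` for the weights `σ`: the mean measures
converge to `ν` weakly, tested against every continuous function, bounded or not. -/
def IsEquilibriumMeasure (σ : ℕ → ℕ → ℝ) (μ : ℕ → Measure ℝ) (ν : Measure ℝ) : Prop :=
  ∀ f : ℝ → ℝ, Continuous f →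
    (∀ n, Integrable f (meanMeasure σ μ n)) ∧ Integrable f ν ∧
      Tendsto (fun n : ℕ => ∫ x, f x ∂(meanMeasure σ μ n)) atTop (𝓝 (∫ x, f x ∂ν))

/-! ### Cesàro weights and the Gegenbauer measures -/

/-- The binomial coefficient with real entries,
`Γ(x + 1) / (Γ(y + 1) Γ(x - y + 1))`. -/
def realBinom (x y : ℝ) : ℝ := Real.Gamma (x + 1) / (Real.Gamma (y + 1) * Real.Gamma (x - y + 1))

/-- The weights of Cesàro `(C, α)` summation,
`σ_{n,k} = binom(n - k + α - 1, n - k) / binom(n + α, n)` for `0 ≤ k ≤ n`. -/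
def cesaroWeight (α : ℝ) (n k : ℕ) : ℝ :=
  realBinom (((n - k : ℕ) : ℝ) + α - 1) ((n - k : ℕ) : ℝ) / realBinom ((n : ℝ) + α) (n : ℝ)

/-- The measure on `[a - 2b, a + 2b]` with density
`(4b² - (x - a)²)^((α - 1)/2) / (2 π b^α binom(α - 1, α/2))`. -/
def intervalGegenbauer (α a b : ℝ) : Measure ℝ :=
  volume.withDensity fun x => ENNReal.ofReal
    ((Set.Icc (a - 2 * b) (a + 2 * b)).indicator
      (fun x => 1 / (2 * Real.pi * b ^ α * realBinom (α - 1) (α / 2)) *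
        (4 * b ^ 2 - (x - a) ^ 2) ^ ((α - 1) / 2)) x)

/-- The normalized Gegenbauer measure on `[-1, 1]`, with density
`(1 - y²)^((α - 1)/2) / ∫_{-1}^{1} (1 - t²)^((α - 1)/2) dt`. -/
def gegenbauer (α : ℝ) : Measure ℝ :=
  volume.withDensity fun y => ENNReal.ofReal
    ((Set.Icc (-1 : ℝ) 1).indicator
      (fun y => 1 / (∫ t in (-1 : ℝ)..1, (1 - t ^ 2) ^ ((α - 1) / 2)) *
        (1 - y ^ 2) ^ ((α - 1) / 2)) y)

end

end MeanNevai

/-!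
The moment `∫ x ^ m (p_k)² dμ` is a diagonal entry of the `m`-th power of the Jacobi matrix of `μ`,
hence a sum over closed walks of length `m` based at `k`, weighted by recurrence coefficients with
indices within distance `m` of `k`. The Cesàro weights at `(n + m, k + m)` and `(n, k)` have a ratio
that does not depend on `k` and tends to `1`, so the mean may be taken over the walks based at
`k + m` instead (`tendsto_cesaro_of_shift`). These see only coefficients with indices `≥ k`, and the
shift conditions of the class allow replacing all of them by `a_k` and `b_k`
(`abs_jacobiPow_sub_walkSum_le`). What remains is the constant-coefficient entry
`(1 / π) ∫ (a_k + 2 b_k cos t) ^ m dt`, a polynomial in `a_k` and `b_k`, whose mean converges by the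
last condition of the class (`tendsto_moment_meanMeasure`).

The limits are the moments of the affine image of the Gegenbauer measure: dividing the arcsine moments
by `binom((α + i) / 2, α / 2)` turns them into the Gegenbauer moments, as both satisfy the same
two-step recursion (`arcsineMoment_mul_realBinom_inv`). That this image has the stated density
amounts to the duplication formula for the Gamma function (`intervalGegenbauer_eq_map`).

Finally, the moment bound by powers of `sup |a| + 2 sup |b|` confines all mean measures to one compact
interval (`meanMeasure_ae_abs_le`), where the Weierstrass theorem passes from moments to all
continuous functions (`tendsto_integral_of_tendsto_moment`). Uniqueness holds because an equilibrium
measure is finite, hence determined by its integrals of bounded continuous functions.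
-/

namespace MeanNevai

/-! ### Cesàro weights -/

lemma realBinom_pos {x y : ℝ} (hx : 0 < x + 1) (hy : 0 < y + 1) (hxy : 0 < x - y + 1) :
    0 < realBinom x y :=
  div_pos (Real.Gamma_pos_of_pos hx)
    (mul_pos (Real.Gamma_pos_of_pos hy) (Real.Gamma_pos_of_pos hxy))

lemma realBinom_add_natCast_pos {α : ℝ} (hα : 0 < α) (n : ℕ) :
    0 < realBinom ((n : ℝ) + α) n := by
  have hn : (0 : ℝ) ≤ n := n.cast_nonneg
  exact realBinom_pos (by linarith) (by linarith) (by linarith)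

lemma cesaroWeight_nonneg {α : ℝ} (hα : 0 < α) (n k : ℕ) : 0 ≤ cesaroWeight α n k := by
  have hn : (0 : ℝ) ≤ (n - k : ℕ) := (n - k).cast_nonneg
  exact div_nonneg (realBinom_pos (by linarith) (by linarith) (by linarith)).le
    (realBinom_add_natCast_pos hα n).le

lemma realBinom_add_natCast_succ {α : ℝ} (hα : 0 < α) (n : ℕ) :
    realBinom (((n + 1 : ℕ) : ℝ) + α) ((n + 1 : ℕ) : ℝ) =
      realBinom ((n : ℝ) + α) n * ((n + 1 + α) / (n + 1)) := by
  have hn : (0 : ℝ) ≤ n := n.cast_nonneg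
  have h1 : Real.Gamma (n + 1 + α + 1) = (n + 1 + α) * Real.Gamma (n + 1 + α) :=
    Real.Gamma_add_one (by positivity)
  have h2 : Real.Gamma ((n : ℝ) + 1 + 1) = (n + 1) * Real.Gamma (n + 1) :=
    Real.Gamma_add_one (by positivity)
  have h3 : (0 : ℝ) < Real.Gamma (n + 1) := Real.Gamma_pos_of_pos (by positivity)
  have h4 : 0 < Real.Gamma (α + 1) := Real.Gamma_pos_of_pos (by positivity)
  simp only [realBinom, Nat.cast_add, Nat.cast_one]
  rw [show (n : ℝ) + 1 + α - (n + 1) + 1 = α + 1 by ring,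
    show (n : ℝ) + α - n + 1 = α + 1 by ring, h1, h2, show (n : ℝ) + α + 1 = n + 1 + α by ring]
  field_simp

lemma tendsto_realBinom_ratio {α : ℝ} (hα : 0 < α) (M : ℕ) :
    Tendsto (fun n : ℕ => realBinom ((n : ℝ) + α) n /
      realBinom (((n + M : ℕ) : ℝ) + α) ((n + M : ℕ) : ℝ)) atTop (𝓝 1) := by
  induction M with
  | zero =>
    refine tendsto_const_nhds.congr fun n => ?_
    rw [Nat.add_zero, div_self (realBinom_add_natCast_pos hα n).ne']
  | succ M ih =>
    have h1 : Tendsto (fun n : ℕ => ((n + M + 1 : ℕ) : ℝ) / ((n + M + 1 : ℕ) + α)) atTop (𝓝 1) :=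
      (tendsto_natCast_div_add_atTop α).comp (tendsto_add_atTop_nat (M + 1))
    have h2 := ih.mul h1
    rw [mul_one] at h2
    refine h2.congr fun n => ?_
    have h3 := realBinom_add_natCast_succ hα (n + M)
    have h4 := realBinom_add_natCast_pos hα (n + M)
    rw [← add_assoc, h3]
    have h5 : (0 : ℝ) < ((n + M : ℕ) : ℝ) + 1 := by positivity
    have h6 : (0 : ℝ) < ((n + M : ℕ) : ℝ) + 1 + α := by positivity
    rw [Nat.cast_succ]
    field_simp

lemma cesaroWeight_add_add {α : ℝ} (hα : 0 < α) (n k M : ℕ) :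
    cesaroWeight α (n + M) (k + M) = realBinom ((n : ℝ) + α) n /
      realBinom (((n + M : ℕ) : ℝ) + α) ((n + M : ℕ) : ℝ) * cesaroWeight α n k := by
  have h := (realBinom_add_natCast_pos hα n).ne'
  rw [cesaroWeight, cesaroWeight, Nat.add_sub_add_right]
  field_simp

/-- Cesàro means of a bounded double sequence do not see a fixed shift of the index `k` at constant
`n - k`: the weights at `(n + M, k + M)` and `(n, k)` have a ratio that tends to `1` and does not
depend on `k`, and the first `M` weights are asymptotically negligible. -/
lemma tendsto_cesaro_of_shift {α : ℝ} (hα : 0 < α)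
    (hmass : Tendsto (fun n : ℕ => ∑ k ∈ Finset.range (n + 1), cesaroWeight α n k) atTop (𝓝 1))
    {F : ℕ → ℕ → ℝ} {K : ℝ} (hF : ∀ N k, |F N k| ≤ K) (M : ℕ) {L : ℝ}
    (h : Tendsto (fun n : ℕ => ∑ k ∈ Finset.range (n + 1),
      cesaroWeight α n k * F (n - k) (k + M)) atTop (𝓝 L)) :
    Tendsto (fun n : ℕ => ∑ k ∈ Finset.range (n + 1),
      cesaroWeight α n k * F (n - k) k) atTop (𝓝 L) := by
  have hρ := tendsto_realBinom_ratio hα M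
  have split : ∀ (G : ℕ → ℕ → ℝ) (n : ℕ),
      ∑ k ∈ Finset.range (n + M + 1), cesaroWeight α (n + M) k * G (n + M - k) k =
        ∑ k ∈ Finset.range M, cesaroWeight α (n + M) k * G (n + M - k) k +
          realBinom ((n : ℝ) + α) n / realBinom (((n + M : ℕ) : ℝ) + α) ((n + M : ℕ) : ℝ) *
            ∑ k ∈ Finset.range (n + 1), cesaroWeight α n k * G (n - k) (k + M) := by
    intro G n
    rw [show n + M + 1 = M + (n + 1) by ring, Finset.sum_range_add, Finset.mul_sum]
    congr 1
    refine Finset.sum_congr rfl fun k _ => ?_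
    rw [add_comm M k, cesaroWeight_add_add hα, Nat.add_sub_add_right, mul_assoc]
  have head : Tendsto (fun n : ℕ => ∑ k ∈ Finset.range M, cesaroWeight α (n + M) k) atTop
      (𝓝 0) := by
    have h1 := ((tendsto_add_atTop_iff_nat M).2 hmass).sub (hρ.mul hmass)
    rw [mul_one, sub_self] at h1
    refine h1.congr fun n => ?_
    have := split (fun _ _ => 1) n
    simp only [mul_one] at this
    rw [this]; ring
  have headF : Tendsto (fun n : ℕ => ∑ k ∈ Finset.range M,
      cesaroWeight α (n + M) k * F (n + M - k) k) atTop (𝓝 0) := by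
    have hK := head.mul_const K
    rw [zero_mul] at hK
    refine squeeze_zero_norm (fun n => ?_) hK
    rw [Finset.sum_mul]
    refine (norm_sum_le _ _).trans (Finset.sum_le_sum fun k _ => ?_)
    rw [norm_mul, Real.norm_eq_abs, Real.norm_eq_abs, abs_of_nonneg (cesaroWeight_nonneg hα _ _)]
    exact mul_le_mul_of_nonneg_left (hF _ _) (cesaroWeight_nonneg hα _ _)
  rw [← tendsto_add_atTop_iff_nat M]
  have := headF.add (hρ.mul h)
  rw [zero_add, one_mul] at this
  exact this.congr fun n => (split F n).symm

/-! ### Jacobi matrices with constant coefficients -/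

/-- The sum over all walks of length `m` from `0` to `d` on `ℤ`, where a step `0` has weight `a` and
a step `±1` has weight `b`, that is, an entry of the `m`-th power of the two-sided Jacobi matrix with
constant coefficients `a` and `b`; it is encoded as a Fourier coefficient of the power of its symbol
`a + 2 b cos t`. -/
noncomputable def walkSum (a b : ℝ) (m : ℕ) (d : ℤ) : ℝ :=
  (∫ t in (0 : ℝ)..Real.pi, (a + 2 * b * Real.cos t) ^ m * Real.cos (d * t)) / Real.pi

lemma walkSum_zero (a b : ℝ) (d : ℤ) : walkSum a b 0 d = if d = 0 then 1 else 0 := by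
  unfold walkSum
  split_ifs with h
  · simp [h, Real.pi_ne_zero]
  · have hd : (d : ℝ) ≠ 0 := by exact_mod_cast h
    simp only [pow_zero, one_mul]
    rw [intervalIntegral.integral_comp_mul_left (fun x => Real.cos x) hd, integral_cos]
    simp

lemma walkSum_succ (a b : ℝ) (m : ℕ) (d : ℤ) :
    walkSum a b (m + 1) d =
      b * walkSum a b m (d + 1) + a * walkSum a b m d + b * walkSum a b m (d - 1) := by
  unfold walkSum
  have hi : ∀ (c : ℝ) (e : ℤ), IntervalIntegrable
      (fun t => c * ((a + 2 * b * Real.cos t) ^ m * Real.cos (e * t))) volume 0 Real.pi :=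
    fun c e => Continuous.intervalIntegrable (by fun_prop) _ _
  have key : (∫ t in (0 : ℝ)..Real.pi, (a + 2 * b * Real.cos t) ^ (m + 1) * Real.cos (d * t)) =
      b * (∫ t in (0 : ℝ)..Real.pi, (a + 2 * b * Real.cos t) ^ m * Real.cos ((d + 1 : ℤ) * t)) +
      a * (∫ t in (0 : ℝ)..Real.pi, (a + 2 * b * Real.cos t) ^ m * Real.cos (d * t)) +
      b * (∫ t in (0 : ℝ)..Real.pi, (a + 2 * b * Real.cos t) ^ m * Real.cos ((d - 1 : ℤ) * t)) := by
    rw [← intervalIntegral.integral_const_mul, ← intervalIntegral.integral_const_mul,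
      ← intervalIntegral.integral_const_mul, ← intervalIntegral.integral_add (hi _ _) (hi _ _),
      ← intervalIntegral.integral_add ((hi _ _).add (hi _ _)) (hi _ _)]
    congr 1
    ext t
    push_cast
    rw [add_mul, sub_mul, one_mul, Real.cos_add, Real.cos_sub]
    ring
  rw [key]
  ring

lemma abs_walkSum_le {a b A B R : ℝ} (ha : |a| ≤ A) (hb : |b| ≤ B) (hR : A + 2 * B ≤ R) (m : ℕ) :
    ∀ d, |walkSum a b m d| ≤ R ^ m := by
  have hB := (abs_nonneg b).trans hb
  have hA := (abs_nonneg a).trans ha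
  induction m with
  | zero =>
    intro d
    rw [walkSum_zero]
    split_ifs <;> simp
  | succ m ih =>
    intro d
    have hRm : 0 ≤ R ^ m := pow_nonneg (by linarith) _
    have h1 : ∀ {c K : ℝ} (e : ℤ), |c| ≤ K → |c * walkSum a b m e| ≤ K * R ^ m := fun {c K} e hc => by
      rw [abs_mul]
      exact mul_le_mul hc (ih e) (abs_nonneg _) ((abs_nonneg c).trans hc)
    rw [walkSum_succ]
    have h2 := abs_add_three (b * walkSum a b m (d + 1)) (a * walkSum a b m d)
      (b * walkSum a b m (d - 1))
    have h3 := mul_le_mul_of_nonneg_right hR hRm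
    rw [pow_succ']
    linarith [h1 (d + 1) hb, h1 d ha, h1 (d - 1) hb]

/-- The `i`-th moment of the arcsine law on `[-1, 1]`. -/
noncomputable def arcsineMoment (i : ℕ) : ℝ := (∫ t in (0 : ℝ)..Real.pi, Real.cos t ^ i) / Real.pi

lemma arcsineMoment_zero : arcsineMoment 0 = 1 := by simp [arcsineMoment, Real.pi_ne_zero]

lemma arcsineMoment_one : arcsineMoment 1 = 0 := by simp [arcsineMoment]

lemma arcsineMoment_add_two (i : ℕ) :
    arcsineMoment (i + 2) = (i + 1) / (i + 2) * arcsineMoment i := by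
  simp only [arcsineMoment]
  rw [integral_cos_pow]
  simp only [Real.sin_pi, Real.sin_zero, mul_zero, sub_self, zero_div, zero_add]
  ring

lemma walkSum_self (a b : ℝ) (m : ℕ) :
    walkSum a b m 0 = ∑ i ∈ Finset.range (m + 1),
      (m.choose i * 2 ^ i * arcsineMoment i) * (a ^ (m - i) * b ^ i) := by
  have h : ∀ t : ℝ, (a + 2 * b * Real.cos t) ^ m * Real.cos ((0 : ℤ) * t) =
      ∑ i ∈ Finset.range (m + 1),
        (m.choose i * 2 ^ i * (a ^ (m - i) * b ^ i)) * Real.cos t ^ i := by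
    intro t
    rw [Int.cast_zero, zero_mul, Real.cos_zero, mul_one, add_comm, add_pow]
    refine Finset.sum_congr rfl fun i _ => ?_
    rw [mul_pow, mul_pow]
    ring
  unfold walkSum
  simp only [h]
  rw [intervalIntegral.integral_finsetSum
    fun i _ => Continuous.intervalIntegrable (by fun_prop) _ _, Finset.sum_div]
  refine Finset.sum_congr rfl fun i _ => ?_
  rw [intervalIntegral.integral_const_mul, arcsineMoment]
  ring

/-! ### Powers of the Jacobi matrix -/

/-- The entry `(i, k)` of the `m`-th power of the Jacobi matrix of `μ`. -/
noncomputable def jacobiPow (μ : Measure ℝ) (m i k : ℕ) : ℝ :=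
  polyInner μ (X ^ m * orthoPoly μ i) (orthoPoly μ k)

variable {μ : Measure ℝ}

lemma jacobiPow_zero (h : IsOrthogonalityMeasure μ) (i k : ℕ) :
    jacobiPow μ 0 i k = if i = k then 1 else 0 := by
  rw [jacobiPow, pow_zero, one_mul, orthoPoly_orthonormal h]

lemma jacobiPow_succ (h : IsOrthogonalityMeasure μ) (m i k : ℕ) :
    jacobiPow μ (m + 1) i k = recB μ (i + 1) * jacobiPow μ m (i + 1) k +
      recA μ i * jacobiPow μ m i k + recB μ i * jacobiPow μ m (i - 1) k := by
  have e : X ^ (m + 1) * orthoPoly μ i = C (recB μ (i + 1)) * (X ^ m * orthoPoly μ (i + 1)) +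
      C (recA μ i) * (X ^ m * orthoPoly μ i) + C (recB μ i) * (X ^ m * orthoPoly μ (i - 1)) := by
    rw [pow_succ, mul_assoc, threeTermRecurrence h]
    ring
  simp only [jacobiPow]
  rw [e, polyInner_add h, polyInner_add h, polyInner_C_mul, polyInner_C_mul, polyInner_C_mul]

lemma abs_jacobiPow_le (h : IsOrthogonalityMeasure μ) {A B R : ℝ} (hA : ∀ n, |recA μ n| ≤ A)
    (hB : ∀ n, |recB μ n| ≤ B) (hR : A + 2 * B ≤ R) (m : ℕ) :
    ∀ i k, |jacobiPow μ m i k| ≤ R ^ m := by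
  have hB0 := (abs_nonneg _).trans (hB 0)
  have hA0 := (abs_nonneg _).trans (hA 0)
  induction m with
  | zero =>
    intro i k
    rw [jacobiPow_zero h]
    split_ifs <;> simp
  | succ m ih =>
    intro i k
    have hRm : 0 ≤ R ^ m := pow_nonneg (by linarith) _
    have h1 : ∀ {c K : ℝ} (e : ℕ), |c| ≤ K → |c * jacobiPow μ m e k| ≤ K * R ^ m :=
      fun {c K} e hc => by
        rw [abs_mul]
        exact mul_le_mul hc (ih e k) (abs_nonneg _) ((abs_nonneg c).trans hc)
    rw [jacobiPow_succ h]
    have h2 := abs_add_three (recB μ (i + 1) * jacobiPow μ m (i + 1) k)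
      (recA μ i * jacobiPow μ m i k) (recB μ i * jacobiPow μ m (i - 1) k)
    have h3 := mul_le_mul_of_nonneg_right hR hRm
    rw [pow_succ']
    linarith [h1 (i + 1) (hB (i + 1)), h1 i (hA i), h1 (i - 1) (hB i)]

/-- The entries of powers of the Jacobi matrix whose walks stay in `[k, k + L]` differ from those of
the Jacobi matrix with the constant coefficients `recA μ k` and `recB μ k` by at most a multiple of
the variation of the coefficients over that range: each step changes one factor. -/
lemma abs_jacobiPow_sub_walkSum_le (h : IsOrthogonalityMeasure μ) {A B R E : ℝ}
    (hA : ∀ n, |recA μ n| ≤ A) (hB : ∀ n, |recB μ n| ≤ B) (hR : A + 2 * B ≤ R) (hR1 : 1 ≤ R)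
    {k L : ℕ} (hEa : ∀ l ≤ L, |recA μ (k + l) - recA μ k| ≤ E)
    (hEb : ∀ l ≤ L, |recB μ (k + l) - recB μ k| ≤ E) (M m : ℕ) :
    ∀ s, m ≤ s → s + m ≤ L →
      |jacobiPow μ m (k + s) (k + M) - walkSum (recA μ k) (recB μ k) m ((s : ℤ) - M)| ≤
        3 * m * R ^ m * E := by
  have hB0 := (abs_nonneg _).trans (hB 0)
  have hA0 := (abs_nonneg _).trans (hA 0)
  have hE0 := (abs_nonneg _).trans (hEa 0 (Nat.zero_le L))
  induction m with
  | zero =>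
    intro s _ _
    have e : ((s : ℤ) - M = 0) ↔ s = M := by omega
    rw [jacobiPow_zero h, walkSum_zero]
    simp [e]
  | succ m ih =>
    intro s hs hsL
    have hRm : 0 ≤ R ^ m := pow_nonneg (by linarith) _
    set a := recA μ k
    set b := recB μ k
    have hw := abs_walkSum_le (hA k) (hB k) hR m
    have step : ∀ {c c' K : ℝ} (s' : ℕ), m ≤ s' → s' + m ≤ L → |c| ≤ K → |c - c'| ≤ E →
        |c * jacobiPow μ m (k + s') (k + M) - c' * walkSum a b m ((s' : ℤ) - M)| ≤
          K * (3 * m * R ^ m * E) + E * R ^ m := by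
      intro c c' K s' h1 h2 hc hcc
      rw [show c * jacobiPow μ m (k + s') (k + M) - c' * walkSum a b m ((s' : ℤ) - M) =
        c * (jacobiPow μ m (k + s') (k + M) - walkSum a b m ((s' : ℤ) - M)) +
          (c - c') * walkSum a b m ((s' : ℤ) - M) by ring]
      refine (abs_add_le _ _).trans (add_le_add ?_ ?_)
      · rw [abs_mul]
        exact mul_le_mul hc (ih s' h1 h2) (abs_nonneg _) ((abs_nonneg c).trans hc)
      · rw [abs_mul]
        exact mul_le_mul hcc (hw _) (abs_nonneg _) hE0
    have s1 := step (s + 1) (by omega) (by omega) (hB (k + (s + 1))) (hEb (s + 1) (by omega))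
    have s2 := step s (by omega) (by omega) (hA (k + s)) (hEa s (by omega))
    have s3 := step (s - 1) (by omega) (by omega) (hB (k + s)) (hEb s (by omega))
    rw [jacobiPow_succ h, walkSum_succ]
    rw [show (s : ℤ) - M + 1 = ((s + 1 : ℕ) : ℤ) - M by push_cast; ring,
      show (s : ℤ) - M - 1 = ((s - 1 : ℕ) : ℤ) - M by omega,
      show k + s - 1 = k + (s - 1) by omega, add_assoc k s 1]
    have key := abs_add_three
      (recB μ (k + (s + 1)) * jacobiPow μ m (k + (s + 1)) (k + M) -
        b * walkSum a b m (((s + 1 : ℕ) : ℤ) - M))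
      (recA μ (k + s) * jacobiPow μ m (k + s) (k + M) - a * walkSum a b m ((s : ℤ) - M))
      (recB μ (k + s) * jacobiPow μ m (k + (s - 1)) (k + M) -
        b * walkSum a b m (((s - 1 : ℕ) : ℤ) - M))
    have hP : 0 ≤ 3 * (m : ℝ) * R ^ m * E := by positivity
    have h4 := mul_le_mul_of_nonneg_right hR hP
    have h5 : E * R ^ m ≤ E * R ^ (m + 1) :=
      mul_le_mul_of_nonneg_left (pow_le_pow_right₀ hR1 (Nat.le_succ m)) hE0
    refine le_trans (le_of_eq_of_le ?_ key) ?_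
    · congr 1; ring
    · have e : 3 * ((m + 1 : ℕ) : ℝ) * R ^ (m + 1) * E =
          R * (3 * m * R ^ m * E) + 3 * (E * R ^ (m + 1)) := by
        push_cast; ring
      rw [e]
      linarith

/-! ### Integrals of the Gegenbauer weight -/

/-- The unnormalized moments of the Gegenbauer weight on `[-1, 1]`. -/
noncomputable def gegenbauerIntegral (α : ℝ) (i : ℕ) : ℝ :=
  ∫ y in (-1 : ℝ)..1, y ^ i * (1 - y ^ 2) ^ ((α - 1) / 2)

lemma intervalIntegrable_gegenbauerWeight {α : ℝ} (hα : 0 < α) :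
    IntervalIntegrable (fun y : ℝ => (1 - y ^ 2) ^ ((α - 1) / 2)) volume (-1) 1 := by
  have h01 : IntervalIntegrable (fun y : ℝ => (1 - y ^ 2) ^ ((α - 1) / 2)) volume 0 1 := by
    have h1 : IntervalIntegrable (fun y : ℝ => (1 - y) ^ ((α - 1) / 2)) volume 0 1 := by
      have h := (intervalIntegral.intervalIntegrable_rpow' (a := 0) (b := 1)
        (r := (α - 1) / 2) (by linarith)).comp_sub_left 1
      simpa using h.symm
    have h2 : ContinuousOn (fun y : ℝ => (1 + y) ^ ((α - 1) / 2)) (Set.uIcc 0 1) := by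
      refine ContinuousOn.rpow_const (by fun_prop) fun x hx => Or.inl ?_
      rw [Set.uIcc_of_le zero_le_one] at hx
      linarith [hx.1]
    refine (h1.mul_continuousOn h2).congr fun y hy => ?_
    rw [Set.uIoc_of_le zero_le_one] at hy
    rw [← Real.mul_rpow (by linarith [hy.2]) (by linarith [hy.1])]
    congr 1; ring
  refine IntervalIntegrable.trans (b := 0) ?_ h01
  have h := (IntervalIntegrable.iff_comp_neg).1 h01
  simpa using h.symm

lemma intervalIntegrable_pow_mul_gegenbauerWeight {α : ℝ} (hα : 0 < α) (i : ℕ) :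
    IntervalIntegrable (fun y : ℝ => y ^ i * (1 - y ^ 2) ^ ((α - 1) / 2)) volume (-1) 1 :=
  (intervalIntegrable_gegenbauerWeight hα).continuousOn_mul (by fun_prop)

lemma hasDerivAt_one_sub_sq_rpow (p : ℝ) {y : ℝ} (hy : y ∈ Set.Ioo (-1 : ℝ) 1) :
    HasDerivAt (fun y : ℝ => (1 - y ^ 2) ^ (p + 1)) (-2 * (p + 1) * (y * (1 - y ^ 2) ^ p)) y := by
  have hpos : 0 < 1 - y ^ 2 := by nlinarith [hy.1, hy.2]
  have h := ((hasDerivAt_pow 2 y).const_sub 1).rpow_const (p := p + 1) (Or.inl hpos.ne')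
  refine h.congr_deriv ?_
  rw [add_sub_cancel_right]
  push_cast
  ring

lemma continuous_one_sub_sq_rpow {p : ℝ} (hp : 0 ≤ p) :
    Continuous fun y : ℝ => (1 - y ^ 2) ^ p :=
  Continuous.rpow_const (by fun_prop) fun _ => Or.inr hp

lemma gegenbauerIntegral_one {α : ℝ} (hα : 0 < α) : gegenbauerIntegral α 1 = 0 := by
  have hp : (α - 1) / 2 + 1 ≠ 0 := by linarith
  have h := intervalIntegral.integral_eq_sub_of_hasDerivAt_of_le (by norm_num : (-1 : ℝ) ≤ 1)
    (continuous_one_sub_sq_rpow (p := (α - 1) / 2 + 1) (by linarith)).continuousOn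
    (fun y hy => hasDerivAt_one_sub_sq_rpow ((α - 1) / 2) hy)
    (by simpa only [pow_one] using
      (intervalIntegrable_pow_mul_gegenbauerWeight hα 1).const_mul _)
  rw [intervalIntegral.integral_const_mul] at h
  simp only [gegenbauerIntegral, pow_one]
  norm_num at h
  exact h.resolve_left hp

/-- The recursion comes from the vanishing boundary values of `y ^ (i + 1) (1 - y²) ^ ((α + 1) / 2)`,
whose derivative is a combination of the two integrands. -/
lemma gegenbauerIntegral_add_two {α : ℝ} (hα : 0 < α) (i : ℕ) :
    gegenbauerIntegral α (i + 2) = (i + 1) / (i + 2 + α) * gegenbauerIntegral α i := by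
  have hp : 0 < (α - 1) / 2 + 1 := by linarith
  have hd : ∀ y ∈ Set.Ioo (-1 : ℝ) 1, HasDerivAt
      (fun y : ℝ => y ^ (i + 1) * (1 - y ^ 2) ^ ((α - 1) / 2 + 1))
      ((i + 1) * (y ^ i * (1 - y ^ 2) ^ ((α - 1) / 2)) -
        (i + 2 + α) * (y ^ (i + 2) * (1 - y ^ 2) ^ ((α - 1) / 2))) y := by
    intro y hy
    have hpos : 0 < 1 - y ^ 2 := by nlinarith [hy.1, hy.2]
    refine ((hasDerivAt_pow (i + 1) y).mul (hasDerivAt_one_sub_sq_rpow _ hy)).congr_deriv ?_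
    rw [Real.rpow_add_one hpos.ne', Nat.add_sub_cancel]
    push_cast
    ring
  have h1 := (intervalIntegrable_pow_mul_gegenbauerWeight hα i).const_mul ((i : ℝ) + 1)
  have h2 := (intervalIntegrable_pow_mul_gegenbauerWeight hα (i + 2)).const_mul ((i : ℝ) + 2 + α)
  have h := intervalIntegral.integral_eq_sub_of_hasDerivAt_of_le (by norm_num : (-1 : ℝ) ≤ 1)
    ((continuous_pow (i + 1)).mul (continuous_one_sub_sq_rpow hp.le)).continuousOn hd (h1.sub h2)
  rw [intervalIntegral.integral_sub h1 h2, intervalIntegral.integral_const_mul,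
    intervalIntegral.integral_const_mul] at h
  norm_num [Real.zero_rpow hp.ne'] at h
  change (i + 1) * gegenbauerIntegral α i - (i + 2 + α) * gegenbauerIntegral α (i + 2) = 0 at h
  have : (i : ℝ) + 2 + α ≠ 0 := by positivity
  field_simp
  linarith

lemma integral_rpow_mul_one_sub_rpow {u : ℝ} (hu : 0 < u) :
    ∫ x in (0 : ℝ)..1, (x * (1 - x)) ^ (u - 1) = Real.Gamma u ^ 2 / Real.Gamma (2 * u) := by
  have h := ProbabilityTheory.beta_eq_betaIntegralReal u u hu hu
  have e : Complex.betaIntegral u u =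
      ((∫ x in (0 : ℝ)..1, (x * (1 - x)) ^ (u - 1) : ℝ) : ℂ) := by
    rw [Complex.betaIntegral, ← intervalIntegral.integral_ofReal]
    refine intervalIntegral.integral_congr fun x hx => ?_
    rw [Set.uIcc_of_le zero_le_one] at hx
    rw [Real.mul_rpow hx.1 (by linarith [hx.2]), Complex.ofReal_mul, Complex.ofReal_cpow hx.1,
      Complex.ofReal_cpow (by linarith [hx.2])]
    push_cast
    rfl
  rw [e, Complex.ofReal_re, ProbabilityTheory.beta] at h
  rw [← h, sq, two_mul]

lemma gegenbauerIntegral_zero {α : ℝ} (hα : 0 < α) :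
    gegenbauerIntegral α 0 = 2 ^ α * Real.Gamma ((α + 1) / 2) ^ 2 / Real.Gamma (α + 1) := by
  have hu : 0 < (α + 1) / 2 := by linarith
  have h := integral_rpow_mul_one_sub_rpow hu
  rw [mul_div_cancel₀ _ (two_ne_zero)] at h
  rw [mul_div_assoc, ← h]
  -- the substitution `y = 2 x - 1`
  have hs := intervalIntegral.integral_comp_mul_add (a := 0) (b := 1)
    (fun y : ℝ => (1 - y ^ 2) ^ ((α - 1) / 2)) (two_ne_zero) (-1)
  have hs' : ∫ x in (0 : ℝ)..1, (1 - (2 * x + -1) ^ 2) ^ ((α - 1) / 2) =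
      2 ^ (α - 1) * ∫ x in (0 : ℝ)..1, (x * (1 - x)) ^ ((α + 1) / 2 - 1) := by
    rw [← intervalIntegral.integral_const_mul]
    refine intervalIntegral.integral_congr fun x hx => ?_
    rw [Set.uIcc_of_le zero_le_one] at hx
    have hx0 : 0 ≤ x * (1 - x) := mul_nonneg hx.1 (by linarith [hx.2])
    rw [show 1 - (2 * x + -1) ^ 2 = (2 : ℝ) ^ (2 : ℝ) * (x * (1 - x)) by norm_num; ring,
      Real.mul_rpow (by positivity) hx0, ← Real.rpow_mul zero_le_two]
    congr 2 <;> ring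
  rw [hs'] at hs
  norm_num at hs
  simp only [gegenbauerIntegral, pow_zero, one_mul]
  rw [Real.rpow_sub_one two_ne_zero] at hs
  linarith

lemma gegenbauerIntegral_zero_pos {α : ℝ} (hα : 0 < α) : 0 < gegenbauerIntegral α 0 := by
  rw [gegenbauerIntegral_zero hα]
  have h1 := Real.Gamma_pos_of_pos (show 0 < (α + 1) / 2 by linarith)
  have h2 := Real.Gamma_pos_of_pos (show 0 < α + 1 by linarith)
  positivity

/-- The two forms of the normalizing constant agree, by two uses of the duplication formula. -/
lemma gegenbauerIntegral_zero_mul_two_rpow {α : ℝ} (hα : 0 < α) :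
    gegenbauerIntegral α 0 * 2 ^ α = 2 * Real.pi * realBinom (α - 1) (α / 2) := by
  have d1 := Real.Gamma_mul_Gamma_add_half (α / 2)
  have d2 := Real.Gamma_mul_Gamma_add_half ((α + 1) / 2)
  rw [show α / 2 + 1 / 2 = (α + 1) / 2 by ring, show 2 * (α / 2) = α by ring] at d1
  rw [show (α + 1) / 2 + 1 / 2 = α / 2 + 1 by ring, show 2 * ((α + 1) / 2) = α + 1 by ring,
    show 1 - (α + 1) = -α by ring] at d2
  have g1 := Real.Gamma_pos_of_pos (show 0 < α / 2 by linarith)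
  have g2 := Real.Gamma_pos_of_pos (show 0 < α / 2 + 1 by linarith)
  have g3 := Real.Gamma_pos_of_pos (show 0 < α + 1 by linarith)
  rw [gegenbauerIntegral_zero hα, realBinom, show α - 1 + 1 = α by ring,
    show α - 1 - α / 2 + 1 = α / 2 by ring, Real.rpow_neg zero_le_two] at *
  rw [Real.rpow_sub zero_lt_two, Real.rpow_one] at d1
  have hpi := Real.mul_self_sqrt Real.pi_pos.le
  have h2 : (0 : ℝ) < 2 ^ α := by positivity
  have prod := congrArg₂ (· * ·) d1 d2
  field_simp at prod ⊢
  rw [Real.sq_sqrt Real.pi_pos.le] at prod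
  linarith

/-! ### The moments of the Gegenbauer measure -/

lemma realBinom_inv_add_two {α : ℝ} (hα : 0 < α) (i : ℕ) :
    (realBinom ((α + (i + 2 : ℕ)) / 2) (α / 2))⁻¹ =
      (i + 2) / (i + 2 + α) * (realBinom ((α + i) / 2) (α / 2))⁻¹ := by
  have hi : (0 : ℝ) ≤ i := i.cast_nonneg
  have h1 : Real.Gamma ((α + i) / 2 + 1 + 1) = ((α + i) / 2 + 1) * Real.Gamma ((α + i) / 2 + 1) :=
    Real.Gamma_add_one (by positivity)
  have h2 : Real.Gamma ((i : ℝ) / 2 + 1 + 1) = (i / 2 + 1) * Real.Gamma (i / 2 + 1) :=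
    Real.Gamma_add_one (by positivity)
  have g1 := Real.Gamma_pos_of_pos (show 0 < α / 2 + 1 by positivity)
  have g2 := Real.Gamma_pos_of_pos (show 0 < (i : ℝ) / 2 + 1 by positivity)
  have g3 := Real.Gamma_pos_of_pos (show 0 < (α + i) / 2 + 1 by positivity)
  simp only [realBinom, Nat.cast_add, Nat.cast_ofNat]
  rw [show (α + (i + 2)) / 2 + 1 = (α + i) / 2 + 1 + 1 by ring,
    show (α + (i + 2)) / 2 - α / 2 + 1 = (i : ℝ) / 2 + 1 + 1 by ring,
    show (α + i) / 2 - α / 2 + 1 = (i : ℝ) / 2 + 1 by ring, h1, h2]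
  field_simp
  ring

lemma realBinom_inv_zero {α : ℝ} (hα : 0 < α) :
    (realBinom ((α + (0 : ℕ)) / 2) (α / 2))⁻¹ = 1 := by
  have g1 := Real.Gamma_pos_of_pos (show 0 < α / 2 + 1 by positivity)
  simp [realBinom, g1.ne']

/-- The moments of the Gegenbauer measure are those of the arcsine law times the coefficients in
the limits of the mean Nevai class: both sides satisfy the same two-step recursion. -/
lemma arcsineMoment_mul_realBinom_inv {α : ℝ} (hα : 0 < α) (i : ℕ) :
    arcsineMoment i * (realBinom ((α + i) / 2) (α / 2))⁻¹ =
      gegenbauerIntegral α i / gegenbauerIntegral α 0 := by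
  induction i using Nat.twoStepInduction with
  | zero => rw [arcsineMoment_zero, realBinom_inv_zero hα,
      div_self (gegenbauerIntegral_zero_pos hα).ne', one_mul]
  | one => rw [arcsineMoment_one, gegenbauerIntegral_one hα, zero_mul, zero_div]
  | more i ih _ =>
    rw [arcsineMoment_add_two, realBinom_inv_add_two hα, gegenbauerIntegral_add_two hα,
      mul_div_assoc, ← ih]
    have : (i : ℝ) + 2 + α ≠ 0 := by positivity
    field_simp

lemma gegenbauer_ae_mem (α : ℝ) : ∀ᵐ y ∂(gegenbauer α), y ∈ Set.Icc (-1 : ℝ) 1 := by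
  rw [ae_iff, gegenbauer]
  refine (withDensity_apply_eq_zero' ?_).2 ?_
  · refine Measurable.aemeasurable (ENNReal.measurable_ofReal.comp (Measurable.indicator ?_
      measurableSet_Icc))
    fun_prop
  · convert measure_empty (μ := (volume : Measure ℝ))
    ext y
    simp only [Set.mem_inter_iff, Set.mem_ofPred_eq, Set.mem_empty_iff_false, iff_false, not_and]
    intro h1 h2
    exact h1 (by rw [Set.indicator_of_notMem h2, ENNReal.ofReal_zero])

lemma measurable_gegenbauerDensity (α : ℝ) : Measurable ((Set.Icc (-1 : ℝ) 1).indicator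
    (fun y => 1 / (∫ t in (-1 : ℝ)..1, (1 - t ^ 2) ^ ((α - 1) / 2)) *
      (1 - y ^ 2) ^ ((α - 1) / 2))) :=
  Measurable.indicator (by fun_prop) measurableSet_Icc

lemma gegenbauerDensity_nonneg {α : ℝ} (y : ℝ) : 0 ≤ (Set.Icc (-1 : ℝ) 1).indicator
    (fun y => 1 / (∫ t in (-1 : ℝ)..1, (1 - t ^ 2) ^ ((α - 1) / 2)) *
      (1 - y ^ 2) ^ ((α - 1) / 2)) y := by
  have hw : ∀ y ∈ Set.Icc (-1 : ℝ) 1, 0 ≤ (1 - y ^ 2) ^ ((α - 1) / 2) := fun y hy =>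
    Real.rpow_nonneg (by nlinarith [hy.1, hy.2]) _
  refine Set.indicator_nonneg (fun y hy => mul_nonneg (one_div_nonneg.2 ?_) (hw y hy)) y
  exact intervalIntegral.integral_nonneg (by norm_num) hw

lemma isFiniteMeasure_gegenbauer {α : ℝ} (hα : 0 < α) : IsFiniteMeasure (gegenbauer α) := by
  refine isFiniteMeasure_withDensity_ofReal (Integrable.hasFiniteIntegral ?_)
  rw [integrable_indicator_iff measurableSet_Icc, ← intervalIntegrable_iff_integrableOn_Icc_of_le
    (by norm_num) enorm_ne_top]
  exact (intervalIntegrable_gegenbauerWeight hα).const_mul _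

lemma integral_gegenbauer_pow (α : ℝ) (i : ℕ) :
    ∫ y, y ^ i ∂(gegenbauer α) = gegenbauerIntegral α i / gegenbauerIntegral α 0 := by
  rw [gegenbauer, integral_withDensity_eq_integral_toReal_smul
    (measurable_gegenbauerDensity α).ennreal_ofReal (by simp)]
  simp only [ENNReal.toReal_ofReal (gegenbauerDensity_nonneg _), smul_eq_mul]
  have hind : ∀ y : ℝ, (Set.Icc (-1 : ℝ) 1).indicator
      (fun y => 1 / (∫ t in (-1 : ℝ)..1, (1 - t ^ 2) ^ ((α - 1) / 2)) *
        (1 - y ^ 2) ^ ((α - 1) / 2)) y * y ^ i = (Set.Icc (-1 : ℝ) 1).indicator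
      (fun y => 1 / (∫ t in (-1 : ℝ)..1, (1 - t ^ 2) ^ ((α - 1) / 2)) *
        (1 - y ^ 2) ^ ((α - 1) / 2) * y ^ i) y := fun y => by
    by_cases hy : y ∈ Set.Icc (-1 : ℝ) 1
    · rw [Set.indicator_of_mem hy, Set.indicator_of_mem hy]
    · rw [Set.indicator_of_notMem hy, Set.indicator_of_notMem hy, zero_mul]
  simp only [hind]
  rw [integral_indicator measurableSet_Icc, integral_Icc_eq_integral_Ioc,
    ← intervalIntegral.integral_of_le (by norm_num)]
  simp only [gegenbauerIntegral, pow_zero, one_mul]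
  rw [← intervalIntegral.integral_div]
  congr 1; ext y; ring

/-! ### The affine image of the Gegenbauer measure -/

lemma map_volume_affine {c : ℝ} (hc : 0 < c) (a : ℝ) :
    Measure.map (fun y : ℝ => c * y + a) volume = ENNReal.ofReal c⁻¹ • volume := by
  have e : (fun y : ℝ => c * y + a) = (fun y => y + a) ∘ (fun y => c * y) := rfl
  rw [e, ← Measure.map_map (by fun_prop) (by fun_prop), Real.map_volume_mul_left hc.ne',
    Measure.map_smul, map_add_right_eq_self, abs_of_pos (inv_pos.2 hc)]

lemma intervalGegenbauer_eq_map {α b : ℝ} (hα : 0 < α) (hb : 0 < b) (a : ℝ) :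
    intervalGegenbauer α a b = (gegenbauer α).map (fun y => 2 * b * y + a) := by
  have hT : Measurable fun y : ℝ => 2 * b * y + a := by fun_prop
  have h2b : 0 < 2 * b := by linarith
  set ρ : ℝ → ENNReal := fun x => ENNReal.ofReal
    ((Set.Icc (a - 2 * b) (a + 2 * b)).indicator
      (fun x => 1 / (2 * Real.pi * b ^ α * realBinom (α - 1) (α / 2)) *
        (4 * b ^ 2 - (x - a) ^ 2) ^ ((α - 1) / 2)) x) with hρdef
  have hρ : Measurable ρ := by
    refine ENNReal.measurable_ofReal.comp (Measurable.indicator ?_ measurableSet_Icc)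
    fun_prop
  have key : ∀ y, ENNReal.ofReal (2 * b) * ρ (2 * b * y + a) = ENNReal.ofReal
      ((Set.Icc (-1 : ℝ) 1).indicator
        (fun y => 1 / (∫ t in (-1 : ℝ)..1, (1 - t ^ 2) ^ ((α - 1) / 2)) *
          (1 - y ^ 2) ^ ((α - 1) / 2)) y) := by
    intro y
    rw [hρdef, ← ENNReal.ofReal_mul h2b.le]
    congr 1
    have hmem : 2 * b * y + a ∈ Set.Icc (a - 2 * b) (a + 2 * b) ↔ y ∈ Set.Icc (-1 : ℝ) 1 := by
      simp only [Set.mem_Icc]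
      constructor
      · rintro ⟨h1, h2⟩; constructor <;> nlinarith
      · rintro ⟨h1, h2⟩; constructor <;> nlinarith
    by_cases hy : y ∈ Set.Icc (-1 : ℝ) 1
    · rw [Set.indicator_of_mem (hmem.2 hy), Set.indicator_of_mem hy]
      have hI := gegenbauerIntegral_zero_pos hα
      have hc := gegenbauerIntegral_zero_mul_two_rpow hα
      have hI0 : gegenbauerIntegral α 0 = ∫ t in (-1 : ℝ)..1, (1 - t ^ 2) ^ ((α - 1) / 2) := by
        simp [gegenbauerIntegral]
      have h1y : 0 ≤ 1 - y ^ 2 := by nlinarith [hy.1, hy.2]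
      rw [← hI0, show 4 * b ^ 2 - (2 * b * y + a - a) ^ 2 = (2 * b) ^ (2 : ℝ) * (1 - y ^ 2) by
          norm_num; ring, Real.mul_rpow (by positivity) h1y, ← Real.rpow_mul h2b.le,
        show 2 * ((α - 1) / 2) = α - 1 by ring, Real.rpow_sub_one h2b.ne',
        Real.mul_rpow zero_le_two hb.le,
        show 2 * Real.pi * b ^ α * realBinom (α - 1) (α / 2) =
          b ^ α * (gegenbauerIntegral α 0 * 2 ^ α) by rw [hc]; ring]
      have : (0 : ℝ) < 2 ^ α := by positivity
      have : 0 < b ^ α := by positivity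
      field_simp
    · rw [Set.indicator_of_notMem (fun h => hy (hmem.1 h)), Set.indicator_of_notMem hy, mul_zero]
  have hvol : (volume : Measure ℝ) =
      ENNReal.ofReal (2 * b) • Measure.map (fun y : ℝ => 2 * b * y + a) volume := by
    rw [map_volume_affine h2b, smul_smul, ← ENNReal.ofReal_mul h2b.le, mul_inv_cancel₀ h2b.ne',
      ENNReal.ofReal_one, one_smul]
  ext s hs
  rw [intervalGegenbauer, withDensity_apply _ hs, Measure.map_apply hT hs, gegenbauer,
    withDensity_apply _ (hT hs)]
  simp only [← key]
  rw [hvol, Measure.restrict_smul, lintegral_smul_measure, setLIntegral_map hs hρ hT, ← hvol,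
    smul_eq_mul]
  exact (lintegral_const_mul _ (hρ.comp hT)).symm

/-! ### Measures with bounded support and convergence of moments -/

lemma integrable_of_ae_abs_le {ν : Measure ℝ} [IsFiniteMeasure ν] {R : ℝ}
    (hR : ∀ᵐ x ∂ν, |x| ≤ R) {f : ℝ → ℝ} (hf : Continuous f) : Integrable f ν := by
  obtain ⟨K, hK⟩ := (isCompact_Icc (a := -R) (b := R)).exists_bound_of_continuousOn hf.continuousOn
  refine Integrable.of_bound hf.aestronglyMeasurable K ?_
  filter_upwards [hR] with x hx
  exact hK x (abs_le.1 hx)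

/-- A measure whose even moments grow at most like powers of `R` lives on `[-R, R]`, by Markov's
inequality. -/
lemma ae_abs_le_of_moment_le {ν : Measure ℝ} [IsFiniteMeasure ν] {K R : ℝ} (hR : 0 < R)
    (hint : ∀ m : ℕ, Integrable (fun x : ℝ => x ^ (2 * m)) ν)
    (hmom : ∀ m : ℕ, ∫ x, x ^ (2 * m) ∂ν ≤ K * R ^ (2 * m)) : ∀ᵐ x ∂ν, |x| ≤ R := by
  have far : ∀ q, R < q → ν {x | q ≤ |x|} = 0 := by
    intro q hq
    have hq0 : 0 < q := hR.trans hq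
    have hle : ∀ m : ℕ, ν.real {x | q ≤ |x|} ≤ K * ((R / q) ^ 2) ^ m := by
      intro m
      have hset : {x : ℝ | q ≤ |x|} ⊆ {x | q ^ (2 * m) ≤ x ^ (2 * m)} := fun x hx => by
        change q ^ (2 * m) ≤ x ^ (2 * m)
        rw [← (even_two_mul m).pow_abs x]
        exact pow_le_pow_left₀ hq0.le hx _
      have hmk := mul_meas_ge_le_integral_of_nonneg
        (Eventually.of_forall fun x : ℝ => (even_two_mul m).pow_nonneg x) (hint m) (q ^ (2 * m))
      have h1 := mul_le_mul_of_nonneg_left (measureReal_mono hset (measure_ne_top ν _))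
        (pow_pos hq0 (2 * m)).le
      have h2 := h1.trans (hmk.trans (hmom m))
      rw [← pow_mul, div_pow, ← mul_div_assoc, le_div_iff₀ (pow_pos hq0 _), mul_comm]
      exact h2
    have hlim : Tendsto (fun m : ℕ => K * ((R / q) ^ 2) ^ m) atTop (𝓝 (K * 0)) :=
      (tendsto_pow_atTop_nhds_zero_of_lt_one (by positivity)
        (pow_lt_one₀ (by positivity) ((div_lt_one hq0).2 hq) two_ne_zero)).const_mul K
    rw [mul_zero] at hlim
    have h0 : ν.real {x | q ≤ |x|} = 0 :=
      le_antisymm (ge_of_tendsto' hlim hle) measureReal_nonneg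
    exact (measureReal_eq_zero_iff (measure_ne_top ν _)).1 h0
  have hall : ∀ᵐ x ∂ν, ∀ n : ℕ, |x| < R + 1 / (n + 1) := by
    refine ae_all_iff.2 fun n => ?_
    rw [ae_iff]
    simp only [not_lt]
    exact far _ (by have : (0 : ℝ) < 1 / (n + 1) := by positivity
                    linarith)
  filter_upwards [hall] with x hx
  refine le_of_forall_pos_lt_add fun ε hε => ?_
  obtain ⟨n, hn⟩ := exists_nat_one_div_lt hε
  exact (hx n).trans (by linarith)

/-- Convergence of moments gives weak convergence, for measures on a common compact interval, by the
Weierstrass approximation theorem. -/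
lemma tendsto_integral_of_tendsto_moment {νs : ℕ → Measure ℝ} {ν : Measure ℝ}
    (hνs : ∀ n, IsFiniteMeasure (νs n)) [IsFiniteMeasure ν] {R : ℝ}
    (hRs : ∀ n, ∀ᵐ x ∂(νs n), |x| ≤ R) (hR : ∀ᵐ x ∂ν, |x| ≤ R)
    (hmom : ∀ m : ℕ, Tendsto (fun n => ∫ x, x ^ m ∂(νs n)) atTop (𝓝 (∫ x, x ^ m ∂ν)))
    {f : ℝ → ℝ} (hf : Continuous f) :
    Tendsto (fun n => ∫ x, f x ∂(νs n)) atTop (𝓝 (∫ x, f x ∂ν)) := by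
  have hpoly : ∀ p : ℝ[X],
      Tendsto (fun n => ∫ x, p.eval x ∂(νs n)) atTop (𝓝 (∫ x, p.eval x ∂ν)) := by
    intro p
    have e : ∀ (κ : Measure ℝ) [IsFiniteMeasure κ], (∀ᵐ x ∂κ, |x| ≤ R) → ∫ x, p.eval x ∂κ =
        ∑ i ∈ Finset.range (p.natDegree + 1), p.coeff i * ∫ x, x ^ i ∂κ := by
      intro κ _ hκ
      simp only [eval_eq_sum_range]
      rw [integral_finsetSum _ fun i _ => integrable_of_ae_abs_le hκ (by fun_prop)]
      simp only [integral_const_mul]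
    rw [e ν hR]
    refine (tendsto_finsetSum _ fun i _ => (hmom i).const_mul (p.coeff i)).congr fun n => ?_
    exact (e (νs n) (hRs n)).symm
  have hmass : Tendsto (fun n => (νs n).real Set.univ) atTop (𝓝 (ν.real Set.univ)) := by
    simpa using hmom 0
  have approx : ∀ (κ : Measure ℝ) [IsFiniteMeasure κ], (∀ᵐ x ∂κ, |x| ≤ R) → ∀ (p : ℝ[X]) (ε : ℝ),
      (∀ x ∈ Set.Icc (-R) R, |p.eval x - f x| < ε) →
      |(∫ x, p.eval x ∂κ) - ∫ x, f x ∂κ| ≤ ε * κ.real Set.univ := by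
    intro κ _ hκ p ε hp
    rw [← integral_sub (integrable_of_ae_abs_le hκ p.continuous) (integrable_of_ae_abs_le hκ hf)]
    rw [← Real.norm_eq_abs]
    refine norm_integral_le_of_norm_le_const ?_
    filter_upwards [hκ] with x hx
    exact (hp x (abs_le.1 hx)).le
  rw [Metric.tendsto_atTop]
  intro δ hδ
  set V := ν.real Set.univ
  have hV : 0 ≤ V := measureReal_nonneg
  have hε : 0 < δ / (2 * V + 3) := by positivity
  obtain ⟨p, hp⟩ := exists_polynomial_near_of_continuousOn (-R) R f hf.continuousOn _ hε
  have h1 := (tendsto_order.1 hmass).2 (V + 1) (by linarith)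
  have h2 := Metric.tendsto_nhds.1 (hpoly p) _ hε
  obtain ⟨N, hN⟩ := eventually_atTop.1 (h1.and h2)
  refine ⟨N, fun n hn => ?_⟩
  obtain ⟨h3, h4⟩ := hN n hn
  have h5 := approx (νs n) (hRs n) p _ hp
  have h6 := approx ν hR p _ hp
  have h7 := mul_le_mul_of_nonneg_left h3.le hε.le
  rw [Real.dist_eq] at h4 ⊢
  have e : δ = δ / (2 * V + 3) * (V + 1) + δ / (2 * V + 3) + δ / (2 * V + 3) * V +
      δ / (2 * V + 3) := by field_simp; ring
  rw [abs_lt] at h4 ⊢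
  rw [abs_le] at h5 h6
  constructor <;> linarith [h5.1, h5.2, h6.1, h6.2, h4.1, h4.2]

/-! ### Mean measures -/

lemma measurable_orthoPolyDensity (κ : Measure ℝ) (k : ℕ) :
    Measurable fun x => ENNReal.ofReal ((orthoPoly κ k).eval x ^ 2) :=
  ENNReal.measurable_ofReal.comp ((orthoPoly κ k).continuous.pow 2).measurable

lemma integrable_withDensity_orthoPoly {κ : Measure ℝ} (h : IsOrthogonalityMeasure κ) (k : ℕ)
    {f : ℝ → ℝ} (hf : Continuous f) :
    Integrable f (κ.withDensity fun x => ENNReal.ofReal ((orthoPoly κ k).eval x ^ 2)) := by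
  rw [integrable_withDensity_iff_integrable_smul' (measurable_orthoPolyDensity κ k) (by simp)]
  simp only [ENNReal.toReal_ofReal (sq_nonneg _), smul_eq_mul]
  exact integrable_continuous h (((orthoPoly κ k).continuous.pow 2).mul hf)

lemma integral_pow_withDensity_orthoPoly (κ : Measure ℝ) (k m : ℕ) :
    ∫ x, x ^ m ∂(κ.withDensity fun x => ENNReal.ofReal ((orthoPoly κ k).eval x ^ 2)) =
      jacobiPow κ m k k := by
  rw [integral_withDensity_eq_integral_toReal_smul (measurable_orthoPolyDensity κ k) (by simp)]
  simp only [ENNReal.toReal_ofReal (sq_nonneg _), smul_eq_mul, jacobiPow, polyInner, eval_mul,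
    eval_pow, eval_X]
  congr 1; ext x; ring

variable {σ : ℕ → ℕ → ℝ} {μ : ℕ → Measure ℝ}

lemma integrable_meanMeasure (hμ : ∀ k, IsOrthogonalityMeasure (μ k)) (n : ℕ) {f : ℝ → ℝ}
    (hf : Continuous f) : Integrable f (meanMeasure σ μ n) :=
  integrable_finsetSum_measure.2 fun k _ =>
    (integrable_withDensity_orthoPoly (hμ (n - k)) k hf).smul_measure ENNReal.ofReal_ne_top

lemma isFiniteMeasure_meanMeasure (hμ : ∀ k, IsOrthogonalityMeasure (μ k)) (n : ℕ) :
    IsFiniteMeasure (meanMeasure σ μ n) :=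
  (integrable_const_iff_isFiniteMeasure one_ne_zero).1
    (integrable_meanMeasure (f := fun _ => (1 : ℝ)) hμ n continuous_const)

lemma integral_pow_meanMeasure (hσ : ∀ n k, 0 ≤ σ n k) (hμ : ∀ k, IsOrthogonalityMeasure (μ k))
    (n m : ℕ) : ∫ x, x ^ m ∂(meanMeasure σ μ n) =
      ∑ k ∈ Finset.range (n + 1), σ n k * jacobiPow (μ (n - k)) m k k := by
  rw [meanMeasure, integral_finsetSum_measure fun k _ =>
    (integrable_withDensity_orthoPoly (hμ (n - k)) k (by fun_prop)).smul_measure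
      ENNReal.ofReal_ne_top]
  refine Finset.sum_congr rfl fun k _ => ?_
  rw [integral_smul_measure, integral_pow_withDensity_orthoPoly, ENNReal.toReal_ofReal (hσ n k),
    smul_eq_mul]

/-- The mean measures live on a common interval because the coefficients are uniformly bounded. -/
lemma meanMeasure_ae_abs_le (hσ : ∀ n k, 0 ≤ σ n k) (hμ : ∀ k, IsOrthogonalityMeasure (μ k))
    {A B R : ℝ} (hA : ∀ n k, |recA (μ k) n| ≤ A) (hB : ∀ n k, |recB (μ k) n| ≤ B)
    (hR : A + 2 * B ≤ R) (hR0 : 0 < R) (n : ℕ) : ∀ᵐ x ∂(meanMeasure σ μ n), |x| ≤ R := by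
  have := isFiniteMeasure_meanMeasure (σ := σ) hμ n
  refine ae_abs_le_of_moment_le (K := ∑ k ∈ Finset.range (n + 1), σ n k) hR0
    (fun m => integrable_meanMeasure hμ n (by fun_prop)) fun m => ?_
  rw [integral_pow_meanMeasure hσ hμ, Finset.sum_mul]
  refine Finset.sum_le_sum fun k _ => mul_le_mul_of_nonneg_left ?_ (hσ n k)
  exact (le_abs_self _).trans
    (abs_jacobiPow_le (hμ _) (fun l => hA l _) (fun l => hB l _) hR _ _ _)

/-! ### Limits of the moments -/

/-- In a mean Nevai class of a Cesàro method the moments of the mean measures converge: after the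
shift of the index by the order `m` of the moment, all walks of length `m` stay among the
coefficients with indices `≥ k`, which may be replaced by the coefficients at `k` itself. -/
lemma tendsto_moment_meanMeasure {α : ℝ} {S : ℕ → ℕ → ℝ} (hα : 0 < α) (hS : S 0 0 = 1)
    (hμ : ∀ k, IsOrthogonalityMeasure (μ k)) (hclass : MeanNevaiClass (cesaroWeight α) μ S)
    (m : ℕ) :
    Tendsto (fun n => ∫ x, x ^ m ∂(meanMeasure (cesaroWeight α) μ n)) atTop
      (𝓝 (∑ i ∈ Finset.range (m + 1), (m.choose i * 2 ^ i * arcsineMoment i) * S (m - i) i)) := by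
  have hσ := cesaroWeight_nonneg hα
  obtain ⟨A, hA⟩ := hclass.bounded_a
  obtain ⟨B, hB⟩ := hclass.bounded_b
  set R := max 1 (A + 2 * B)
  have hR : A + 2 * B ≤ R := le_max_right _ _
  have hR1 : 1 ≤ R := le_max_left _ _
  simp only [integral_pow_meanMeasure hσ hμ]
  have hmass : Tendsto (fun n : ℕ => ∑ k ∈ Finset.range (n + 1), cesaroWeight α n k) atTop
      (𝓝 1) := by
    simpa [hS] using hclass.limits 0 0
  refine tendsto_cesaro_of_shift (F := fun N k => jacobiPow (μ N) m k k) hα hmass (K := R ^ m)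
    (fun N k => abs_jacobiPow_le (hμ _) (fun l => hA l _) (fun l => hB l _) hR _ _ _) m ?_
  -- the constant-coefficient approximation has the required limit
  have hmain : Tendsto (fun n : ℕ => ∑ k ∈ Finset.range (n + 1), cesaroWeight α n k *
      walkSum (recA (μ (n - k)) k) (recB (μ (n - k)) k) m 0) atTop
      (𝓝 (∑ i ∈ Finset.range (m + 1), (m.choose i * 2 ^ i * arcsineMoment i) * S (m - i) i)) := by
    refine (tendsto_finsetSum _ fun i _ => (hclass.limits (m - i) i).const_mul
      (m.choose i * 2 ^ i * arcsineMoment i)).congr fun n => ?_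
    simp only [walkSum_self, Finset.mul_sum]
    rw [Finset.sum_comm]
    exact Finset.sum_congr rfl fun k _ => Finset.sum_congr rfl fun i _ => by ring
  let E : ℕ → ℕ → ℝ := fun N k => ∑ l ∈ Finset.range (2 * m + 1),
    (|recA (μ N) (k + l) - recA (μ N) k| + |recB (μ N) (k + l) - recB (μ N) k|)
  have hE : Tendsto (fun n : ℕ => ∑ k ∈ Finset.range (n + 1), cesaroWeight α n k * E (n - k) k)
      atTop (𝓝 0) := by
    have h : ∀ l ∈ Finset.range (2 * m + 1), Tendsto (fun n : ℕ =>
        (∑ k ∈ Finset.range (n + 1), cesaroWeight α n k *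
          |recA (μ (n - k)) (k + l) - recA (μ (n - k)) k|) +
        ∑ k ∈ Finset.range (n + 1), cesaroWeight α n k *
          |recB (μ (n - k)) (k + l) - recB (μ (n - k)) k|) atTop (𝓝 0) := by
      intro l _
      rcases Nat.eq_zero_or_pos l with rfl | hl
      · simp
      · simpa using (hclass.shift_a l hl).add (hclass.shift_b l hl)
    have h' := tendsto_finsetSum _ h
    rw [Finset.sum_const_zero] at h'
    refine h'.congr fun n => ?_
    simp only [E, Finset.mul_sum, mul_add, ← Finset.sum_add_distrib]
    rw [Finset.sum_comm]
  have herr : Tendsto (fun n : ℕ => ∑ k ∈ Finset.range (n + 1), cesaroWeight α n k *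
      (jacobiPow (μ (n - k)) m (k + m) (k + m) -
        walkSum (recA (μ (n - k)) k) (recB (μ (n - k)) k) m 0)) atTop (𝓝 0) := by
    have hE' := hE.const_mul (3 * m * R ^ m)
    rw [mul_zero] at hE'
    refine squeeze_zero_norm (fun n => ?_) hE'
    rw [Finset.mul_sum]
    refine (norm_sum_le _ _).trans (Finset.sum_le_sum fun k _ => ?_)
    have hterm : ∀ l ≤ 2 * m, |recA (μ (n - k)) (k + l) - recA (μ (n - k)) k| +
        |recB (μ (n - k)) (k + l) - recB (μ (n - k)) k| ≤ E (n - k) k := fun l hl =>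
      Finset.single_le_sum (f := fun l => |recA (μ (n - k)) (k + l) - recA (μ (n - k)) k| +
        |recB (μ (n - k)) (k + l) - recB (μ (n - k)) k|)
        (fun _ _ => by positivity) (Finset.mem_range.2 (by omega))
    have hw := abs_jacobiPow_sub_walkSum_le (hμ (n - k)) (fun l => hA l _) (fun l => hB l _) hR hR1
      (L := 2 * m) (E := E (n - k) k)
      (fun l hl => (le_add_of_nonneg_right (abs_nonneg _)).trans (hterm l hl))
      (fun l hl => (le_add_of_nonneg_left (abs_nonneg _)).trans (hterm l hl)) m m m le_rfl
      (by omega)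
    rw [sub_self] at hw
    rw [norm_mul, Real.norm_eq_abs, Real.norm_eq_abs, abs_of_nonneg (hσ n k), mul_left_comm]
    exact mul_le_mul_of_nonneg_left hw (hσ n k)
  have := herr.add hmain
  rw [zero_add] at this
  refine this.congr fun n => ?_
  rw [← Finset.sum_add_distrib]
  exact Finset.sum_congr rfl fun k _ => by ring

lemma integral_pow_intervalGegenbauer {α b : ℝ} (hα : 0 < α) (hb : 0 < b) (a : ℝ) (m : ℕ) :
    ∫ x, x ^ m ∂(intervalGegenbauer α a b) = ∑ i ∈ Finset.range (m + 1),
      (m.choose i * 2 ^ i * arcsineMoment i) *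
        (a ^ (m - i) * b ^ i * (realBinom ((α + i) / 2) (α / 2))⁻¹) := by
  have := isFiniteMeasure_gegenbauer hα
  have hae : ∀ᵐ y ∂(gegenbauer α), |y| ≤ 1 := by
    filter_upwards [gegenbauer_ae_mem α] with y hy using abs_le.2 hy
  rw [intervalGegenbauer_eq_map hα hb,
    integral_map (by fun_prop) (Continuous.aestronglyMeasurable (by fun_prop))]
  simp only [add_pow]
  rw [integral_finsetSum _ fun i _ => integrable_of_ae_abs_le hae (by fun_prop)]
  refine Finset.sum_congr rfl fun i _ => ?_
  rw [integral_mul_const, integral_mul_const]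
  simp only [mul_pow]
  rw [integral_const_mul, integral_gegenbauer_pow, ← arcsineMoment_mul_realBinom_inv hα]
  ring

lemma isFiniteMeasure_intervalGegenbauer {α b : ℝ} (hα : 0 < α) (hb : 0 < b) (a : ℝ) :
    IsFiniteMeasure (intervalGegenbauer α a b) := by
  have := isFiniteMeasure_gegenbauer hα
  rw [intervalGegenbauer_eq_map hα hb]
  infer_instance

lemma intervalGegenbauer_ae_abs_le {α b : ℝ} (hα : 0 < α) (hb : 0 < b) (a : ℝ) :
    ∀ᵐ x ∂(intervalGegenbauer α a b), |x| ≤ |a| + 2 * b := by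
  rw [intervalGegenbauer_eq_map hα hb, ae_map_iff (by fun_prop)
    (measurableSet_le (by fun_prop) (by fun_prop))]
  filter_upwards [gegenbauer_ae_mem α] with y hy
  have h1 : |2 * b * y| ≤ 2 * b := by
    rw [abs_mul, abs_of_pos (by linarith : 0 < 2 * b)]
    exact mul_le_of_le_one_right (by linarith) (abs_le.2 hy)
  linarith [abs_add_le (2 * b * y) a]

lemma IsEquilibriumMeasure.isFiniteMeasure {ν : Measure ℝ} (h : IsEquilibriumMeasure σ μ ν) :
    IsFiniteMeasure ν :=
  (integrable_const_iff_isFiniteMeasure one_ne_zero).1 (h (fun _ => (1 : ℝ)) continuous_const).2.1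

lemma IsEquilibriumMeasure.eq {ν ν' : Measure ℝ} (h : IsEquilibriumMeasure σ μ ν)
    (h' : IsEquilibriumMeasure σ μ ν') : ν = ν' := by
  have := h.isFiniteMeasure
  have := h'.isFiniteMeasure
  exact ext_of_forall_integral_eq_of_IsFiniteMeasure fun f =>
    tendsto_nhds_unique (h f f.continuous).2.2 (h' f f.continuous).2.2

end MeanNevai

open MeanNevai in
theorem mainTheorem8 (α a b : ℝ) (hα : 0 < α) (hb : 0 < b)
    (μ : ℕ → Measure ℝ) (hμ : ∀ k, MeanNevai.IsOrthogonalityMeasure (μ k))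
    (hclass : MeanNevai.MeanNevaiClass (MeanNevai.cesaroWeight α) μ
      (fun i j => a ^ i * b ^ j * (MeanNevai.realBinom ((α + j) / 2) (α / 2))⁻¹)) :
    (∀ ν : Measure ℝ, MeanNevai.IsEquilibriumMeasure (MeanNevai.cesaroWeight α) μ ν ↔
      ν = MeanNevai.intervalGegenbauer α a b) ∧
    MeanNevai.intervalGegenbauer α a b =
      (MeanNevai.gegenbauer α).map (fun y => 2 * b * y + a) := by
  refine ⟨?_, intervalGegenbauer_eq_map hα hb a⟩
  have hσ := cesaroWeight_nonneg hα
  have hfin := isFiniteMeasure_intervalGegenbauer hα hb a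
  have hG : IsEquilibriumMeasure (cesaroWeight α) μ (intervalGegenbauer α a b) := by
    intro f hf
    have hsupp := intervalGegenbauer_ae_abs_le hα hb a
    refine ⟨fun n => integrable_meanMeasure hμ n hf, integrable_of_ae_abs_le hsupp hf, ?_⟩
    obtain ⟨A, hA⟩ := hclass.bounded_a
    obtain ⟨B, hB⟩ := hclass.bounded_b
    refine tendsto_integral_of_tendsto_moment (R := max (|a| + 2 * b) (A + 2 * B))
      (isFiniteMeasure_meanMeasure hμ)
      (meanMeasure_ae_abs_le hσ hμ hA hB (le_max_right _ _)
        (lt_max_of_lt_left (by positivity)))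
      (hsupp.mono fun x hx => hx.trans (le_max_left _ _)) (fun m => ?_) hf
    rw [integral_pow_intervalGegenbauer hα hb]
    refine tendsto_moment_meanMeasure hα ?_ hμ hclass m
    simpa using realBinom_inv_zero hα
  intro ν
  exact ⟨fun hν => hν.eq hG, fun hν => hν ▸ hG⟩
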